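/- Let $k$ be a field of prime characteristic $p>0$, let $W=(w_{ij})$ and $Z=(z_{ij})$ be $3\times 3$ matrices of indeterminates, and let $k[W,Z]$ be the polynomial ring over $k$ in these $18$ indeterminates. Put $$\begin{aligned} f_1&=w_{21}z_{12}-w_{12}z_{21}+w_{23}z_{32}-w_{32}z_{23},\\ f_2&=w_{22}z_{21}-w_{21}z_{22}+w_{23}z_{31}-w_{31}z_{23}+w_{21}z_{11}-w_{11}z_{21},\\ f_3&=w_{13}z_{32}-w_{32}z_{13}-w_{22}z_{12}+w_{12}z_{22}-w_{12}z_{11}+w_{11}z_{12},\\ f_4&=w_{12}z_{21}-w_{21}z_{12}+w_{13}z_{31}-w_{31}z_{13}, \end{aligned}$$ and $T=k[W,Z]/(f_1,f_2,f_3,f_4)$. Then $f_1,f_2,f_3,f_4$ is a regular sequence on $k[W,Z]$, so that $T$ is a complete intersection, and $T$ is (strongly) $F$-regular, that is: $T$ is Noetherian and reduced, and for every $c\in T$ that lies in no minimal prime of $T$ there is $q=p^e$ with $e\ge 0$ such that the $T$-linear map $T\to T^{1/q}$, $1\mapsto c^{1/q}$, splits. -/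

import Mathlib

section FRegularity

/-- For a ring `R` of prime characteristic `p`, the ring `R^{1/q}` with `q = p ^ e`, as an
`R`-algebra.  Its underlying ring is a copy of `R`, in which the copy of `x` plays the role of
`x^{1/q}`; under this identification the inclusion `R → R^{1/q}` is the `e`-th iterate of the
Frobenius.  (When `R` is reduced, this is the ring of `q`-th roots of the elements of `R`.) -/
def FrobeniusRoot (R : Type*) (_p _e : ℕ) : Type _ := R

namespace FrobeniusRoot

variable (R : Type*) [CommRing R] (p e : ℕ)

instance : CommRing (FrobeniusRoot R p e) := inferInstanceAs (CommRing R)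

/-- The ring isomorphism `R ≃ R^{1/q}`, `x ↦ x^{1/q}`, where `q = p ^ e`. -/
def root : R ≃+* FrobeniusRoot R p e := RingEquiv.refl R

variable [ExpChar R p]

instance : Algebra R (FrobeniusRoot R p e) :=
  ((root R p e).toRingHom.comp (iterateFrobenius R p e)).toAlgebra

/-- `x^{1/q}` is indeed a `q`-th root of (the image of) `x`. -/
theorem root_pow (x : R) : root R p e x ^ p ^ e = algebraMap R (FrobeniusRoot R p e) x :=
  (map_pow (root R p e) x (p ^ e)).symm

/-- The `R`-module structure of `R^{1/q}`: `r • x^{1/q} = (r^q x)^{1/q}`. -/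
theorem smul_root (r x : R) : r • root R p e x = root R p e (r ^ p ^ e * x) := by
  rw [Algebra.smul_def, ← root_pow, map_mul, map_pow]

end FrobeniusRoot

/-- Strong `F`-regularity of a ring `R` of prime characteristic `p`: `R` is Noetherian and reduced,
and for each `c` outside all minimal primes of `R` there is `q = p ^ e` such that the `R`-linear map
`R → R^{1/q}`, `1 ↦ c^{1/q}`, splits. -/
structure IsStronglyFRegular (p : ℕ) [Fact p.Prime] (R : Type*) [CommRing R] [CharP R p] :
    Prop where
  isNoetherianRing : IsNoetherianRing R
  isReduced : IsReduced R
  exists_splitting : ∀ c : R, (∀ P ∈ minimalPrimes R, c ∉ P) →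
    ∃ (e : ℕ) (φ : FrobeniusRoot R p e →ₗ[R] R),
      φ ∘ₗ LinearMap.toSpanSingleton R (FrobeniusRoot R p e) (FrobeniusRoot.root R p e c) =
        LinearMap.id

end FRegularity

namespace CommutatorT

open MvPolynomial

/-- The polynomial ring `k[W, Z]` in the 18 entries of two `3 × 3` matrices of indeterminates. -/
abbrev Poly (k : Type*) [Field k] : Type _ :=
  MvPolynomial ((Fin 3 × Fin 3) ⊕ (Fin 3 × Fin 3)) k

variable (k : Type*) [Field k]

/-- The matrix of indeterminates `W`; rows and columns are numbered from `0`, so that the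
indeterminate written `w₂₁` on paper is `W k 1 0`. -/
noncomputable def W : Matrix (Fin 3) (Fin 3) (Poly k) := Matrix.of fun i j => X (Sum.inl (i, j))

/-- The matrix of indeterminates `Z`, numbered in the same way. -/
noncomputable def Z : Matrix (Fin 3) (Fin 3) (Poly k) := Matrix.of fun i j => X (Sum.inr (i, j))

/-- `w₂₁z₁₂ - w₁₂z₂₁ + w₂₃z₃₂ - w₃₂z₂₃`. -/
noncomputable def f₁ : Poly k :=
  W k 1 0 * Z k 0 1 - W k 0 1 * Z k 1 0 + W k 1 2 * Z k 2 1 - W k 2 1 * Z k 1 2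

/-- `w₂₂z₂₁ - w₂₁z₂₂ + w₂₃z₃₁ - w₃₁z₂₃ + w₂₁z₁₁ - w₁₁z₂₁`. -/
noncomputable def f₂ : Poly k :=
  W k 1 1 * Z k 1 0 - W k 1 0 * Z k 1 1 + W k 1 2 * Z k 2 0 - W k 2 0 * Z k 1 2
    + W k 1 0 * Z k 0 0 - W k 0 0 * Z k 1 0

/-- `w₁₃z₃₂ - w₃₂z₁₃ - w₂₂z₁₂ + w₁₂z₂₂ - w₁₂z₁₁ + w₁₁z₁₂`. -/
noncomputable def f₃ : Poly k :=
  W k 0 2 * Z k 2 1 - W k 2 1 * Z k 0 2 - W k 1 1 * Z k 0 1 + W k 0 1 * Z k 1 1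
    - W k 0 1 * Z k 0 0 + W k 0 0 * Z k 0 1

/-- `w₁₂z₂₁ - w₂₁z₁₂ + w₁₃z₃₁ - w₃₁z₁₃`. -/
noncomputable def f₄ : Poly k :=
  W k 0 1 * Z k 1 0 - W k 1 0 * Z k 0 1 + W k 0 2 * Z k 2 0 - W k 2 0 * Z k 0 2

/-- The ideal `(f₁, f₂, f₃, f₄)` of `k[W, Z]`. -/
noncomputable def relations : Ideal (Poly k) := Ideal.span {f₁ k, f₂ k, f₃ k, f₄ k}

/-- The ring `T = k[W, Z] / (f₁, f₂, f₃, f₄)`. -/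
abbrev T : Type _ := Poly k ⧸ relations k

theorem relations_ne_top : relations k ≠ ⊤ := by
  intro h
  have hle : relations k ≤ RingHom.ker (MvPolynomial.aeval (R := k)
      (fun _ : (Fin 3 × Fin 3) ⊕ (Fin 3 × Fin 3) => (0 : k))).toRingHom := by
    refine Ideal.span_le.2 ?_
    rintro x (rfl | rfl | rfl | rfl) <;> simp [f₁, f₂, f₃, f₄, W, Z]
  have h1 := hle (h ▸ Submodule.mem_top : (1 : Poly k) ∈ relations k)
  simp at h1

instance : Nontrivial (T k) := Ideal.Quotient.nontrivial_iff.2 (relations_ne_top k)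

/-- `T` has the same characteristic as `k`. -/
instance (p : ℕ) [CharP k p] : CharP (T k) p :=
  charP_of_injective_algebraMap (algebraMap k (T k)).injective p

end CommutatorT

/-!
Give the indeterminates weights such that the terms of largest weight of `f₁`, `f₂`, `f₃`, `f₄` are
`-w₃₂z₂₃`, `w₂₁z₁₁`, `w₁₁z₁₂`, `w₁₃z₃₁`, and that of `c = z₂₁(z₁₃w₂₃ - z₂₃w₁₃)` is `z₂₁z₁₃w₂₃`.  These
monomials are pairwise coprime and squarefree, and everything follows from that.

Polynomials with pairwise coprime leading monomials are a Gröbner basis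
(`MonomialOrder.exists_degree_le_of_mem_span`), and each of them is a nonzerodivisor modulo the
others (`MonomialOrder.mem_span_of_mul_mem_span`).  Hence `f₁, f₂, f₃, f₄, c` is a regular sequence.

For strong `F`-regularity, the `T`-linear maps `T^{1/q} → T` are viewed as additive maps `φ` of `T`
with `φ (a ^ q * b) = a * φ b` (`IsCartierMap`), and `d ≠ 0` has to be sent to `1` by one of them.
This is done in two stages.

* Where `c` is invertible, the four equations can be solved for `w₁₁`, `w₁₂`, `w₃₂`, `z₃₂`, so that
  `T[1/c]` is a localization of a polynomial ring.  As `c` is a nonzerodivisor, `T` is a domain.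
  Polynomial rings are strongly `F`-regular, and clearing denominators yields a Cartier map of `T`
  that sends `d` to some power `c ^ N` (`exists_isCartierMap_eq_pow`).
* With `F = f₁f₂f₃f₄`, the leading monomial of `F ^ (q - 1) * c ^ N` divides the product of the
  `(q - 1)`-st powers of the indeterminates once `q` is large.  As in Fedder's criterion, this gives
  a Cartier map of `T` that sends `c ^ N` to `1` (`exists_isCartierMap_quotient`).

The composite of the two maps sends `d` to `1`.
-/

/-! ### Weighted monomial orders -/

open scoped MonomialOrder

universe u

namespace MonomialOrder

variable {σ : Type*}

theorem nonempty_of_finite (σ : Type u) [Finite σ] : Nonempty (MonomialOrder.{u, u} σ) := by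
  obtain ⟨n, ⟨e⟩⟩ := Finite.exists_equiv_fin σ
  let _ : LinearOrder σ := LinearOrder.lift' e e.injective
  exact ⟨MonomialOrder.lex⟩

/-- The copy of `m.syn` that carries the order of `MonomialOrder.weighted w m`. -/
def WeightedSyn (_w : σ → ℕ) (m : MonomialOrder σ) : Type _ := m.syn

namespace WeightedSyn

variable (w : σ → ℕ) (m : MonomialOrder σ)

noncomputable instance : AddCommMonoid (WeightedSyn w m) := inferInstanceAs (AddCommMonoid m.syn)

/-- The pair of the weight of an exponent and the exponent itself. -/
noncomputable def toProd : WeightedSyn w m →+ ℕ × m.syn :=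
  ((Finsupp.weight w).comp m.toSyn.symm.toAddMonoidHom).prod (AddMonoidHom.id m.syn)

noncomputable instance : LinearOrder (WeightedSyn w m) :=
  LinearOrder.lift' (fun a => toLex (toProd w m a))
    fun _ _ h => congrArg Prod.snd (toLex.injective h)

/-- The identification of exponents with the elements of `WeightedSyn w m`. -/
noncomputable def ofExponent : (σ →₀ ℕ) ≃+ WeightedSyn w m :=
  (m.toSyn : (σ →₀ ℕ) ≃+ m.syn)

theorem toProd_ofExponent (a : σ →₀ ℕ) :
    toProd w m (ofExponent w m a) = (Finsupp.weight w a, m.toSyn a) :=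
  Prod.ext (congrArg (Finsupp.weight w) (m.toSyn.symm_apply_apply a)) rfl

variable {w m}

theorem le_iff {a b : WeightedSyn w m} : a ≤ b ↔ toLex (toProd w m a) ≤ toLex (toProd w m b) :=
  Iff.rfl

theorem lt_iff {a b : WeightedSyn w m} : a < b ↔ toLex (toProd w m a) < toLex (toProd w m b) :=
  Iff.rfl

instance : IsOrderedAddMonoid (WeightedSyn w m) where
  add_le_add_left a b h c := by
    rw [le_iff] at h ⊢
    simp only [map_add, toLex_add]
    exact add_le_add_left h _

instance : WellFoundedLT (WeightedSyn w m) :=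
  ⟨(InvImage.wf (fun a => toLex (toProd w m a)) wellFounded_lt)⟩

end WeightedSyn

/-- The monomial order that compares weights first, and breaks ties by means of `m`. -/
noncomputable def weighted (w : σ → ℕ) (m : MonomialOrder σ) : MonomialOrder σ where
  syn := WeightedSyn w m
  toSyn := WeightedSyn.ofExponent w m
  toSyn_monotone a b h := by
    rw [WeightedSyn.le_iff, WeightedSyn.toProd_ofExponent, WeightedSyn.toProd_ofExponent]
    refine Prod.Lex.toLex_mono ⟨?_, m.toSyn_monotone h⟩
    obtain ⟨c, rfl⟩ := exists_add_of_le h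
    simp

theorem weighted_lt_of_weight_lt {w : σ → ℕ} {m : MonomialOrder σ} {a b : σ →₀ ℕ}
    (h : Finsupp.weight w a < Finsupp.weight w b) : a ≺[weighted w m] b := by
  change WeightedSyn.ofExponent w m a < WeightedSyn.ofExponent w m b
  rw [WeightedSyn.lt_iff, WeightedSyn.toProd_ofExponent, WeightedSyn.toProd_ofExponent]
  exact Prod.Lex.toLex_lt_toLex.2 (Or.inl h)

/-- A monomial plus terms of smaller weight has that monomial as its leading monomial. -/
theorem degree_weighted_monomial_add {k : Type*} [CommRing k] {w : σ → ℕ} {m : MonomialOrder σ}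
    {s : σ →₀ ℕ} {u : k} (hu : u ≠ 0) {g : MvPolynomial σ k}
    (hg : g ∈ MvPolynomial.restrictSupport k {d | Finsupp.weight w d < Finsupp.weight w s}) :
    (weighted w m).degree (MvPolynomial.monomial s u + g) = s := by
  classical
  by_cases h0 : g = 0
  · simp [h0, degree_monomial, hu]
  · rw [degree_add_of_lt]
    · rw [degree_monomial, if_neg hu]
    · rw [degree_monomial, if_neg hu]
      exact weighted_lt_of_weight_lt
        ((MvPolynomial.mem_restrictSupport_iff k).1 hg (degree_mem_support h0))

/-! ### Polynomials with coprime leading monomials -/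

section Coprime

variable {ι k : Type*} [Field k] {m : MonomialOrder σ} {f : ι → MvPolynomial σ k}

/-- Division with remainder by the `f i`, `i ∈ s`, keeping only the congruence and the reducedness of
the remainder. -/
theorem exists_remainder (hf : ∀ i, f i ≠ 0) (s : Set ι) (h : MvPolynomial σ k) :
    ∃ r, h - r ∈ Ideal.span (f '' s) ∧ ∀ c ∈ r.support, ∀ i ∈ s, ¬ m.degree (f i) ≤ c := by
  obtain ⟨g, r, hgr, -, hr⟩ := m.div_set (B := f '' s) (by
    rintro _ ⟨i, -, rfl⟩
    exact (m.leadingCoeff_ne_zero_iff.2 (hf i)).isUnit) h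
  refine ⟨r, ?_, fun c hc i hi => hr c hc _ ⟨i, hi, rfl⟩⟩
  rw [hgr, add_sub_cancel_right, Finsupp.linearCombination_apply]
  exact Ideal.sum_mem _ fun b _ => Ideal.mul_mem_left _ _ (Ideal.subset_span b.2)

theorem le_of_le_add_of_disjoint {a b c : σ →₀ ℕ} (h : a ≤ b + c) (hd : Disjoint a c) :
    a ≤ b := by
  intro x
  have h1 := h x
  have h2 : (a ⊓ c) x = 0 := by rw [hd.eq_bot]; rfl
  simp only [Finsupp.inf_apply, Finsupp.coe_add, Pi.add_apply] at h1 h2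
  omega

/-- Polynomials with pairwise coprime leading monomials form a Gröbner basis. -/
theorem exists_degree_le_of_mem_span (hf : ∀ i, f i ≠ 0) (s : Finset ι)
    (hd : (s : Set ι).Pairwise fun i j => Disjoint (m.degree (f i)) (m.degree (f j)))
    {h : MvPolynomial σ k} (hh : h ∈ Ideal.span (f '' s)) (h0 : h ≠ 0) :
    ∃ i ∈ s, m.degree (f i) ≤ m.degree h := by
  classical
  induction s using Finset.induction_on generalizing h with
  | empty => simp at hh; exact absurd hh h0
  | insert a s ha ih =>
    have hds := hd.mono (Finset.coe_subset.2 (Finset.subset_insert a s))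
    rw [Finset.coe_insert, Set.image_insert_eq, Ideal.mem_span_insert] at hh
    obtain ⟨b, g, hg, rfl⟩ := hh
    -- the cofactor of `f a` only matters modulo the other generators
    obtain ⟨r, hr, hr'⟩ := exists_remainder (m := m) hf s b
    have hg' : g + (b - r) * f a ∈ Ideal.span (f '' s) :=
      add_mem hg (Ideal.mul_mem_right _ _ hr)
    have hsplit : b * f a + g = (g + (b - r) * f a) + r * f a := by ring
    rw [hsplit] at h0 ⊢
    set g' := g + (b - r) * f a
    by_cases hr0 : r = 0
    · simp only [hr0, zero_mul, add_zero] at h0 ⊢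
      obtain ⟨i, hi, hi'⟩ := ih hds hg' h0
      exact ⟨i, Finset.mem_insert_of_mem hi, hi'⟩
    have hdeg : m.degree (r * f a) = m.degree r + m.degree (f a) := degree_mul hr0 (hf a)
    by_cases hg0 : g' = 0
    · refine ⟨a, Finset.mem_insert_self _ _, ?_⟩
      rw [hg0, zero_add, hdeg]
      exact le_add_self
    obtain ⟨i, hi, hi'⟩ := ih hds hg' hg0
    have hne : m.degree g' ≠ m.degree (r * f a) := by
      intro heq
      rw [heq, hdeg] at hi'
      refine hr' _ (degree_mem_support hr0) i hi (le_of_le_add_of_disjoint hi' ?_)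
      exact hd (by simp [hi]) (by simp) (by rintro rfl; exact ha hi)
    rcases lt_or_gt_of_ne (m.toSyn.injective.ne hne) with hlt | hlt
    · refine ⟨a, Finset.mem_insert_self _ _, ?_⟩
      rw [degree_add_eq_right_of_lt hlt, hdeg]
      exact le_add_self
    · exact ⟨i, Finset.mem_insert_of_mem hi, by rwa [degree_add_of_lt hlt]⟩

/-- A polynomial whose leading monomial is coprime to the pairwise coprime leading monomials of the
generators of an ideal is a nonzerodivisor modulo that ideal. -/
theorem mem_span_of_mul_mem_span (hf : ∀ i, f i ≠ 0) (s : Finset ι)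
    (hd : (s : Set ι).Pairwise fun i j => Disjoint (m.degree (f i)) (m.degree (f j)))
    {c : MvPolynomial σ k} (hc : c ≠ 0) (hcd : ∀ i ∈ s, Disjoint (m.degree (f i)) (m.degree c))
    {h : MvPolynomial σ k} (hh : h * c ∈ Ideal.span (f '' s)) : h ∈ Ideal.span (f '' s) := by
  obtain ⟨r, hr, hr'⟩ := exists_remainder (m := m) hf s h
  rcases eq_or_ne r 0 with rfl | hr0
  · simpa using hr
  have hrc : r * c ∈ Ideal.span (f '' s) := by
    have := sub_mem hh (Ideal.mul_mem_right c _ hr)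
    ring_nf at this ⊢
    exact this
  obtain ⟨i, hi, hi'⟩ := exists_degree_le_of_mem_span hf s hd hrc (mul_ne_zero hr0 hc)
  rw [degree_mul hr0 hc] at hi'
  exact absurd (le_of_le_add_of_disjoint hi' (hcd i hi)) (hr' _ (degree_mem_support hr0) i hi)

/-- Polynomials with pairwise coprime leading monomials form a regular sequence, in any order. -/
theorem isWeaklyRegular_ofFn {n : ℕ} {f : Fin n → MvPolynomial σ k} (hf : ∀ i, f i ≠ 0)
    (hd : Pairwise fun i j => Disjoint (m.degree (f i)) (m.degree (f j))) :
    RingTheory.Sequence.IsWeaklyRegular (MvPolynomial σ k) (List.ofFn f) := by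
  refine ⟨fun i hi => ?_⟩
  have hin : i < n := by simpa using hi
  have hspan : Ideal.ofList ((List.ofFn f).take i) • (⊤ : Ideal (MvPolynomial σ k))
      = Ideal.span (f '' (Finset.Iio (⟨i, hin⟩ : Fin n))) := by
    rw [smul_eq_mul, Ideal.mul_top, Ideal.ofList]
    congr 1
    ext x
    simp only [List.mem_take_iff_getElem, List.getElem_ofFn, List.length_ofFn, Finset.coe_Iio,
      Set.mem_image, Set.mem_Iio, Set.mem_ofPred_eq]
    constructor
    · rintro ⟨j, hj, rfl⟩
      exact ⟨⟨j, by omega⟩, by simp [Fin.lt_def]; omega, rfl⟩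
    · rintro ⟨j, hj, rfl⟩
      exact ⟨j, by have : j.1 < i := hj; omega, rfl⟩
  rw [hspan, isSMulRegular_iff_right_eq_zero_of_smul]
  intro x hx
  obtain ⟨x, rfl⟩ := Ideal.Quotient.mk_surjective x
  have hx' : (List.ofFn f)[i] * x ∈ Ideal.span (f '' (Finset.Iio (⟨i, hin⟩ : Fin n))) :=
    Ideal.Quotient.eq_zero_iff_mem.1 hx
  rw [List.getElem_ofFn, mul_comm] at hx'
  refine Ideal.Quotient.eq_zero_iff_mem.2 (mem_span_of_mul_mem_span hf _ (hd.set_pairwise _)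
    (hf _) (fun j hj => hd ?_) hx')
  exact (Finset.mem_Iio.1 hj).ne

end Coprime

end MonomialOrder

/-! ### Maps that are linear with respect to an inverse of Frobenius -/

/-- An additive map `φ : R → R` with `φ (a ^ q * b) = a * φ b`.  For `q = p ^ e` in characteristic
`p` these maps are the `R`-linear maps `R^{1/q} → R`, read through `R ≃ R^{1/q}`. -/
def IsCartierMap {R : Type*} [CommRing R] (q : ℕ) (φ : R →+ R) : Prop :=
  ∀ a b, φ (a ^ q * b) = a * φ b

namespace IsCartierMap

variable {R : Type*} [CommRing R] {q r : ℕ} {φ ψ : R →+ R}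

theorem comp (hφ : IsCartierMap q φ) (hψ : IsCartierMap r ψ) :
    IsCartierMap (q * r) (φ.comp ψ) := fun a b => by
  simp only [AddMonoidHom.comp_apply, pow_mul, hψ (a ^ q) b, hφ a]

theorem comp_mulLeft (hφ : IsCartierMap q φ) (c : R) :
    IsCartierMap q (φ.comp (AddMonoidHom.mulLeft c)) := fun a b => by
  simp only [AddMonoidHom.comp_apply, AddMonoidHom.coe_mulLeft, ← hφ a]
  congr 1
  ring

/-- A Cartier map that preserves the kernel of a surjection descends along it. -/
theorem exists_descend {S : Type*} [CommRing S] {π : R →+* S} (hπ : Function.Surjective π)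
    (hφ : IsCartierMap q φ) (hker : ∀ x, π x = 0 → π (φ x) = 0) :
    ∃ ψ : S →+ S, IsCartierMap q ψ ∧ ∀ x, ψ (π x) = π (φ x) := by
  let ψ : S →+ S := AddMonoidHom.liftOfRightInverse π.toAddMonoidHom (Function.surjInv hπ)
    (Function.rightInverse_surjInv hπ) ⟨π.toAddMonoidHom.comp φ, fun x hx => hker x hx⟩
  have hψ : ∀ x, ψ (π x) = π (φ x) := fun x =>
    AddMonoidHom.liftOfRightInverse_comp_apply π.toAddMonoidHom (Function.surjInv hπ)
      (Function.rightInverse_surjInv hπ) ⟨π.toAddMonoidHom.comp φ, fun x hx => hker x hx⟩ x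
  refine ⟨ψ, fun a b => ?_, hψ⟩
  obtain ⟨a, rfl⟩ := hπ a
  obtain ⟨b, rfl⟩ := hπ b
  rw [← map_pow, ← map_mul, hψ, hφ, map_mul, hψ]

/-- A Cartier map sending `c` to `1` is a splitting of `R → R^{1/q}`, `1 ↦ c^{1/q}`. -/
theorem exists_splitting {p e : ℕ} [ExpChar R p] (hφ : IsCartierMap (p ^ e) φ) {c : R}
    (hc : φ c = 1) : ∃ φ : FrobeniusRoot R p e →ₗ[R] R,
      φ ∘ₗ LinearMap.toSpanSingleton R (FrobeniusRoot R p e) (FrobeniusRoot.root R p e c) =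
        LinearMap.id := by
  refine ⟨{ toFun := fun x => φ ((FrobeniusRoot.root R p e).symm x)
            map_add' := fun x y => by rw [map_add, map_add]
            map_smul' := fun a x => ?_ }, ?_⟩
  · obtain ⟨x, rfl⟩ := (FrobeniusRoot.root R p e).surjective x
    rw [FrobeniusRoot.smul_root, RingEquiv.symm_apply_apply, RingEquiv.symm_apply_apply, hφ]
    rfl
  · refine LinearMap.ext_ring ?_
    simp [hc]

end IsCartierMap

theorem exists_isCartierMap_field (k : Type*) [Field k] (p e : ℕ) [ExpChar k p] {u : k}
    (hu : u ≠ 0) : ∃ l : k →+ k, IsCartierMap (p ^ e) l ∧ l u = 1 := by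
  let v := FrobeniusRoot.root k p e u
  obtain ⟨g, hg⟩ := LinearMap.exists_leftInverse_of_injective
    (LinearMap.toSpanSingleton k (FrobeniusRoot k p e) v) (by
      rw [LinearMap.ker_eq_bot']
      intro a ha
      rw [LinearMap.toSpanSingleton_apply, FrobeniusRoot.smul_root,
        EmbeddingLike.map_eq_zero_iff] at ha
      exact pow_eq_zero_iff (pow_ne_zero e (expChar_pos k p).ne') |>.1
        ((mul_eq_zero.1 ha).resolve_right hu))
  refine ⟨g.toAddMonoidHom.comp (FrobeniusRoot.root k p e).toAddEquiv.toAddMonoidHom,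
    fun a b => ?_, ?_⟩
  · change g (FrobeniusRoot.root k p e _) = a * g (FrobeniusRoot.root k p e b)
    rw [← FrobeniusRoot.smul_root, map_smul, smul_eq_mul]
  · simpa using LinearMap.congr_fun hg 1

/-! ### Cartier maps of polynomial rings -/

namespace MvPolynomial

variable {σ k : Type*} [Field k]

theorem injective_add_nsmul {q : ℕ} (hq : q ≠ 0) (γ : σ →₀ ℕ) :
    Function.Injective fun α : σ →₀ ℕ => γ + q • α := fun α β h => by
  ext x
  have := DFunLike.congr_fun (add_left_cancel h) x
  simpa [hq] using this

/-- The additive map `∑ u_β x^β ↦ ∑ l(u_{γ+qα}) x^α`.  If `l` is a Cartier map of `k` and the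
entries of `γ` are less than `q`, it is a Cartier map; it picks out one coordinate with respect to
the basis `x^{β/q}`, `β < q`, of `k[x^{1/q}]` over `k[x]`. -/
noncomputable def cartierCoordinate {q : ℕ} (hq : q ≠ 0) (γ : σ →₀ ℕ) (l : k →+ k) :
    MvPolynomial σ k →+ MvPolynomial σ k :=
  (AddMonoidAlgebra.coeffAddEquiv.symm.toAddMonoidHom.comp
    ((Finsupp.mapRange.addMonoidHom l).comp
      (Finsupp.comapDomain.addMonoidHom (injective_add_nsmul hq γ)))).comp
    AddMonoidAlgebra.coeffAddEquiv.toAddMonoidHom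

theorem coeff_cartierCoordinate {q : ℕ} (hq : q ≠ 0) (γ : σ →₀ ℕ) (l : k →+ k) (α : σ →₀ ℕ)
    (f : MvPolynomial σ k) :
    coeff α (cartierCoordinate hq γ l f) = l (coeff (γ + q • α) f) := rfl

theorem isCartierMap_cartierCoordinate {p e : ℕ} [ExpChar k p] (hq : p ^ e ≠ 0) {γ : σ →₀ ℕ}
    (hγ : ∀ x, γ x < p ^ e) {l : k →+ k} (hl : IsCartierMap (p ^ e) l) :
    IsCartierMap (p ^ e) (cartierCoordinate hq γ l) := by
  intro g f
  induction g using MvPolynomial.induction_on' with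
  | add g h hg hh => rw [add_pow_expChar_pow, add_mul, map_add, hg, hh, add_mul]
  | monomial δ a =>
    ext α
    have hiff : p ^ e • δ ≤ γ + p ^ e • α ↔ δ ≤ α := by
      constructor
      · intro h x
        have h1 := h x
        have h2 := hγ x
        simp only [Finsupp.coe_add, Pi.add_apply, Finsupp.coe_smul, Pi.smul_apply,
          smul_eq_mul] at h1
        by_contra! h3
        have : p ^ e * (α x + 1) ≤ p ^ e * δ x := Nat.mul_le_mul_left _ h3
        rw [mul_add, mul_one] at this
        omega
      · intro h
        exact (nsmul_le_nsmul_right h _).trans le_add_self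
    rw [coeff_cartierCoordinate, monomial_pow, coeff_monomial_mul', coeff_monomial_mul']
    by_cases h : δ ≤ α
    · rw [if_pos h, if_pos (hiff.2 h), hl, coeff_cartierCoordinate]
      obtain ⟨β, rfl⟩ := exists_add_of_le h
      rw [add_tsub_cancel_left, smul_add, add_left_comm, add_tsub_cancel_left]
    · rw [if_neg h, if_neg (hiff.not.2 h), map_zero]

/-- If no exponent `γ + qα` with `α ≠ 0` occurs in `f`, then the coordinate of `f` at `γ` is a
constant. -/
theorem cartierCoordinate_eq_one {q : ℕ} (hq : q ≠ 0) {γ : σ →₀ ℕ} {l : k →+ k}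
    {f : MvPolynomial σ k} (h : ∀ α, α ≠ 0 → coeff (γ + q • α) f = 0) (h1 : l (coeff γ f) = 1) :
    cartierCoordinate hq γ l f = 1 := by
  classical
  ext α
  rw [coeff_cartierCoordinate, coeff_one]
  split_ifs with hα
  · rw [← hα, smul_zero, add_zero, h1]
  · rw [h α (Ne.symm hα), map_zero]

/-- Polynomial rings over a field of characteristic `p` are strongly `F`-regular: once `p ^ e` exceeds
the degree of `d`, the coefficients of `d` are themselves the coordinates of `d^{1/q}`, up to `q`-th
roots. -/
theorem exists_isCartierMap_eq_one (p : ℕ) [Fact p.Prime] [CharP k p] {d : MvPolynomial σ k}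
    (hd : d ≠ 0) : ∃ e, ∃ φ : MvPolynomial σ k →+ MvPolynomial σ k,
      IsCartierMap (p ^ e) φ ∧ φ d = 1 := by
  have hp : 1 < p := (Fact.out : p.Prime).one_lt
  obtain ⟨γ, hγ⟩ := ne_zero_iff.1 hd
  have hlt : ∀ β ∈ d.support, ∀ x, β x < p ^ d.totalDegree := fun β hβ x =>
    ((Finsupp.le_degree x β).trans (le_totalDegree hβ)).trans_lt (Nat.lt_pow_self hp)
  obtain ⟨l, hl, hl1⟩ := exists_isCartierMap_field k p d.totalDegree hγ
  have hq : p ^ d.totalDegree ≠ 0 := by positivity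
  refine ⟨d.totalDegree, cartierCoordinate hq γ l, isCartierMap_cartierCoordinate hq
    (hlt γ (mem_support_iff.2 hγ)) hl, cartierCoordinate_eq_one hq (fun α hα => ?_) hl1⟩
  obtain ⟨x, hx⟩ := Finsupp.ne_iff.1 hα
  by_contra h
  have h1 := hlt _ (mem_support_iff.2 h) x
  simp only [Finsupp.coe_add, Pi.add_apply, Finsupp.coe_smul, Pi.smul_apply, smul_eq_mul] at h1
  have h2 : p ^ d.totalDegree * 1 ≤ p ^ d.totalDegree * α x :=
    Nat.mul_le_mul_left _ (Nat.one_le_iff_ne_zero.2 hx)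
  omega

end MvPolynomial

/-! ### Splittings of quotients with squarefree leading monomials -/

section SquarefreeLeadingTerm

open MvPolynomial

variable {σ ι k : Type*} [Field k] [Fintype ι] {m : MonomialOrder σ} {f : ι → MvPolynomial σ k}

theorem pairwise_disjoint_degree (hsq : ∀ x, ∑ i, m.degree (f i) x ≤ 1) :
    Pairwise fun i j => Disjoint (m.degree (f i)) (m.degree (f j)) := by
  classical
  intro i j hij
  rw [disjoint_iff]
  ext x
  have h1 : ∑ a ∈ {i, j}, m.degree (f a) x ≤ ∑ a, m.degree (f a) x :=
    Finset.sum_le_sum_of_subset (Finset.subset_univ _)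
  have h2 := hsq x
  rw [Finset.sum_pair hij] at h1
  simp only [Finsupp.inf_apply, bot_eq_zero, Finsupp.coe_zero, Pi.zero_apply]
  omega

/-- A form of Fedder's criterion.  Let the product `F` of the `f i` have a squarefree leading
monomial, coprime to that of `c`.  For large `q = p ^ e`, the exponents in the leading monomial of
`F ^ (q - 1) * c ^ N` are at most `q - 1`, so that multiplication by `F ^ (q - 1)` and by a suitable
monomial, followed by a coordinate function, maps `c ^ N` to `1`; because of the factor
`F ^ (q - 1)` this map preserves the ideal generated by the `f i`. -/
theorem exists_isCartierMap_quotient [Finite σ] (p : ℕ) [Fact p.Prime] [CharP k p]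
    (hf : ∀ i, f i ≠ 0) (hsq : ∀ x, ∑ i, m.degree (f i) x ≤ 1) {c : MvPolynomial σ k}
    (hc : c ≠ 0) (hcd : ∀ i, Disjoint (m.degree (f i)) (m.degree c)) (N : ℕ) :
    ∃ e, ∃ φ : (MvPolynomial σ k ⧸ Ideal.span (Set.range f)) →+ _,
      IsCartierMap (p ^ e) φ ∧ φ (Ideal.Quotient.mk _ c ^ N) = 1 := by
  classical
  have hp : 1 < p := (Fact.out : p.Prime).one_lt
  set e := N * (m.degree c).degree
  have hq : p ^ e ≠ 0 := by positivity
  set F := ∏ i, f i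
  have hF : F ≠ 0 := Finset.prod_ne_zero_iff.2 fun i _ => hf i
  set G := F ^ (p ^ e - 1) * c ^ N
  have hG : G ≠ 0 := mul_ne_zero (pow_ne_zero _ hF) (pow_ne_zero _ hc)
  have hGdeg : m.degree G = (p ^ e - 1) • ∑ i, m.degree (f i) + N • m.degree c := by
    rw [MonomialOrder.degree_mul (pow_ne_zero _ hF) (pow_ne_zero _ hc), MonomialOrder.degree_pow,
      MonomialOrder.degree_pow, MonomialOrder.degree_prod fun i _ => hf i]
  -- every exponent equal to `q - 1`
  set γ : σ →₀ ℕ := Finsupp.equivFunOnFinite.symm fun _ => p ^ e - 1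
  have hγ : ∀ x, γ x = p ^ e - 1 := fun x => rfl
  have hle : m.degree G ≤ γ := by
    intro x
    simp only [hGdeg, hγ, Finsupp.coe_add, Pi.add_apply, Finsupp.coe_smul, Pi.smul_apply,
      smul_eq_mul, Finsupp.finsetSum_apply]
    by_cases hx : m.degree c x = 0
    · rw [hx, mul_zero, add_zero]
      exact (Nat.mul_le_mul_left _ (hsq x)).trans_eq (mul_one _)
    · have h0 : ∑ i, m.degree (f i) x = 0 := by
        refine Finset.sum_eq_zero fun i _ => ?_
        have := DFunLike.congr_fun (disjoint_iff.1 (hcd i)) x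
        simp only [Finsupp.inf_apply, bot_eq_zero, Finsupp.coe_zero, Pi.zero_apply] at this
        omega
      rw [h0, mul_zero, zero_add]
      have h1 : N * m.degree c x ≤ e := Nat.mul_le_mul_left _ (Finsupp.le_degree x _)
      have h2 : e < p ^ e := Nat.lt_pow_self hp
      omega
  obtain ⟨l, hl, hl1⟩ := exists_isCartierMap_field k p e (m.leadingCoeff_ne_zero_iff.2 hG)
  set g : MvPolynomial σ k := monomial (γ - m.degree G) 1
  have hg : g ≠ 0 := by simp [g]
  have hdeg : m.degree (G * g) = γ := by
    rw [MonomialOrder.degree_mul hG hg, MonomialOrder.degree_monomial, if_neg one_ne_zero,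
      add_tsub_cancel_of_le hle]
  have hφ := (isCartierMap_cartierCoordinate hq (γ := γ)
    (fun x => by rw [hγ]; omega) hl).comp_mulLeft (F ^ (p ^ e - 1) * g)
  obtain ⟨ψ, hψ, hψφ⟩ := hφ.exists_descend (π := Ideal.Quotient.mk (Ideal.span (Set.range f)))
    Ideal.Quotient.mk_surjective (by
      intro x hx
      rw [Ideal.Quotient.eq_zero_iff_mem] at hx ⊢
      obtain ⟨a, rfl⟩ := Ideal.mem_span_range_iff_exists_fun.1 hx
      rw [map_sum]
      refine Ideal.sum_mem _ fun i _ => ?_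
      -- `F ^ (q - 1) * f i` is a multiple of `f i ^ q`, and `f i ^ q` comes out as `f i`
      have hFi : F ^ (p ^ e - 1) * g * (a i * f i) =
          f i ^ p ^ e * ((∏ j ∈ Finset.univ.erase i, f j) ^ (p ^ e - 1) * g * a i) := by
        rw [show F = f i * ∏ j ∈ Finset.univ.erase i, f j from
          (Finset.mul_prod_erase _ _ (Finset.mem_univ i)).symm, mul_pow,
          ← pow_sub_one_mul hq (f i)]
        ring
      rw [AddMonoidHom.comp_apply, AddMonoidHom.coe_mulLeft, hFi,
        isCartierMap_cartierCoordinate hq (fun x => by rw [hγ]; omega) hl]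
      exact Ideal.mul_mem_right _ _ (Ideal.subset_span ⟨i, rfl⟩))
  refine ⟨e, ψ, hψ, ?_⟩
  rw [← map_pow, hψφ, ← map_one (Ideal.Quotient.mk _)]
  congr 1
  have hGg : F ^ (p ^ e - 1) * g * c ^ N = G * g := by simp only [G]; ring
  rw [AddMonoidHom.comp_apply, AddMonoidHom.coe_mulLeft, hGg]
  -- the leading monomial of `G * g` is `x ^ γ`, and each `x ^ (γ + q • α)` with `α ≠ 0` is larger
  refine cartierCoordinate_eq_one hq (fun α hα => ?_) ?_
  · refine m.coeff_eq_zero_of_lt ?_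
    rw [hdeg, map_add]
    refine lt_add_of_pos_right _ ((MonomialOrder.toSyn_lt_iff_ne_zero _).2 ?_)
    rwa [Ne, MonomialOrder.toSyn_eq_zero_iff, smul_eq_zero_iff_right hq]
  · rw [← hdeg]
    change l (m.leadingCoeff (G * g)) = 1
    rw [MonomialOrder.leadingCoeff_mul, MonomialOrder.leadingCoeff_monomial, mul_one, hl1]

end SquarefreeLeadingTerm

/-! ### Algebras that become a localized polynomial ring -/

section BirationalPolynomialRing

open MvPolynomial

variable {k τ T : Type*} [Field k] [CommRing T] [Algebra k T]
  {ι : MvPolynomial τ k →ₐ[k] T} {c : MvPolynomial τ k}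

/-- An algebra `T` that contains a polynomial ring, and agrees with it after inverting a
nonzerodivisor `c` of `T` from that polynomial ring, is a domain. -/
theorem isDomain_of_generically_polynomial (hι : Function.Injective ι)
    (hc : ι c ∈ nonZeroDivisors T) (hT : ∀ t, ∃ M, ι c ^ M * t ∈ ι.range) : IsDomain T := by
  have : Nontrivial T := hι.nontrivial
  have key : ∀ t : T, t ≠ 0 → ∃ M, ∃ g : MvPolynomial τ k, g ≠ 0 ∧ ι g = ι c ^ M * t := by
    intro t ht
    obtain ⟨M, g, hg⟩ := hT t
    refine ⟨M, g, ?_, hg⟩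
    rintro rfl
    have h0 : t * ι c ^ M = 0 := by
      rw [mul_comm, ← hg]
      exact map_zero ι
    exact ht ((mul_right_mem_nonZeroDivisors_eq_zero_iff (pow_mem hc M)).1 h0)
  have : NoZeroDivisors T := ⟨fun {s t} hst => by
    by_contra! h
    obtain ⟨M, g, hg, hg'⟩ := key s h.1
    obtain ⟨N, g', hg0, hg0'⟩ := key t h.2
    refine mul_ne_zero hg hg0 (hι ?_)
    rw [map_mul, hg', hg0', map_zero, mul_mul_mul_comm, hst, mul_zero]⟩
  exact NoZeroDivisors.to_isDomain T

/-- If inverting `c` turns the finitely generated algebra `T` into a localization of a polynomial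
ring, then each nonzero `d : T` is mapped to a power of `c` by a Cartier map.  A Cartier map `Φ` of
the polynomial ring with value `1` at a multiple of `d` extends to the localization, and a power of
`c` times that extension preserves `T`.  No finiteness of `k` over its `p`-th powers is needed,
since the coefficients in `k` do not contribute to the denominators. -/
theorem exists_isCartierMap_eq_pow (p : ℕ) [Fact p.Prime] [CharP k p] [Algebra.FiniteType k T]
    (hι : Function.Injective ι) (hc : ι c ∈ nonZeroDivisors T)
    (hT : ∀ t, ∃ M, ι c ^ M * t ∈ ι.range) {d : T} (hd : d ≠ 0) :
    ∃ e, ∃ φ : T →+ T, IsCartierMap (p ^ e) φ ∧ ∃ N, φ d = ι c ^ N := by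
  obtain ⟨M₀, d', hd'⟩ := hT d
  replace hd' : ι d' = ι c ^ M₀ * d := hd'
  have hcr : ι c ∈ ι.range := ⟨c, rfl⟩
  have hcM : ∀ M, ι c ^ M ∈ nonZeroDivisors T := pow_mem hc
  have hd'0 : d' ≠ 0 := by
    rintro rfl
    rw [map_zero, eq_comm, mul_left_mem_nonZeroDivisors_eq_zero_iff (hcM M₀)] at hd'
    exact hd hd'
  obtain ⟨e, Φ, hΦ, hΦ1⟩ := exists_isCartierMap_eq_one p hd'0
  set q := p ^ e
  obtain ⟨n, π, hπ⟩ := Algebra.FiniteType.iff_quotient_mvPolynomial''.1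
    (inferInstance : Algebra.FiniteType k T)
  -- a common exponent for the generators of `T`
  obtain ⟨B, hB⟩ : ∃ B, ∀ i, ι c ^ B * π (X i) ∈ ι.range := by
    choose B hB using fun i => hT (π (X i))
    refine ⟨∑ i, B i, fun i => ?_⟩
    rw [← Finset.sum_erase_add _ _ (Finset.mem_univ i), pow_add, mul_assoc]
    exact mul_mem (pow_mem hcr _) (hB i)
  -- the graph of `ι c ^ (n * B)` times the extension of `Φ` to the fractions `ι g / ι c ^ (q * M)`
  let Rel : T → T → Prop := fun t s => ∃ M g, ι c ^ (q * M) * t = ι g ∧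
    ι c ^ M * s = ι c ^ (n * B) * ι (Φ g)
  have hΦc : ∀ M g, Φ (c ^ (q * M) * g) = c ^ M * Φ g := fun M g => by
    rw [mul_comm q M, pow_mul, hΦ]
  have hlift : ∀ {t s M g} (N : ℕ), ι c ^ (q * M) * t = ι g →
      ι c ^ M * s = ι c ^ (n * B) * ι (Φ g) →
      ι c ^ (q * (M + N)) * t = ι (c ^ (q * N) * g) ∧
        ι c ^ (M + N) * s = ι c ^ (n * B) * ι (Φ (c ^ (q * N) * g)) := by
    intro t s M g N h1 h2
    constructor
    · rw [mul_add, pow_add, map_mul, ← h1, map_pow]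
      ring
    · rw [hΦc, map_mul, map_pow, mul_left_comm, ← h2, pow_add]
      ring
  have hfun : ∀ t s s', Rel t s → Rel t s' → s = s' := by
    rintro t s s' ⟨M, g, h1, h2⟩ ⟨M', g', h1', h2'⟩
    obtain ⟨h3, h4⟩ := hlift M' h1 h2
    obtain ⟨h3', h4'⟩ := hlift M h1' h2'
    rw [add_comm M' M] at h3' h4'
    rw [h3] at h3'
    rw [← hι h3', ← h4] at h4'
    exact ((mul_cancel_left_mem_nonZeroDivisors (hcM _)).1 h4').symm
  have hadd : ∀ t s t' s', Rel t s → Rel t' s' → Rel (t + t') (s + s') := by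
    rintro t s t' s' ⟨M, g, h1, h2⟩ ⟨M', g', h1', h2'⟩
    obtain ⟨h3, h4⟩ := hlift M' h1 h2
    obtain ⟨h3', h4'⟩ := hlift M h1' h2'
    rw [add_comm M' M] at h3' h4'
    exact ⟨M + M', _, by rw [mul_add, h3, h3', ← map_add],
      by rw [mul_add, h4, h4', map_add, map_add, mul_add]⟩
  have hsmul : ∀ a t s, Rel t s → Rel (a ^ q * t) (a * s) := by
    rintro a t s ⟨M, g, h1, h2⟩
    obtain ⟨L, b, hb⟩ := hT a
    replace hb : ι b = ι c ^ L * a := hb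
    refine ⟨M + L, b ^ q * g, ?_, ?_⟩
    · rw [map_mul, map_pow, hb, ← h1, mul_add, pow_add, mul_pow, ← pow_mul, mul_comm L q]
      ring
    · rw [hΦ, map_mul, hb, pow_add]
      linear_combination a * ι c ^ L * h2
  have htot : ∀ t, ∃ s, Rel t s := by
    intro t
    obtain ⟨t, rfl⟩ := hπ t
    induction t using MvPolynomial.induction_on' with
    | add t t' ht ht' =>
      obtain ⟨s, hs⟩ := ht
      obtain ⟨s', hs'⟩ := ht'
      exact ⟨s + s', by rw [map_add]; exact hadd _ _ _ _ hs hs'⟩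
    | monomial u a =>
      -- split off the `q`-th power part of the monomial
      have hu : π (monomial u a) = (∏ i, π (X i) ^ (u i / q)) ^ q *
          (algebraMap k T a * ∏ i, π (X i) ^ (u i % q)) := by
        rw [monomial_eq, map_mul, Finsupp.prod_fintype _ _ (by simp), map_prod,
          ← Finset.prod_pow, mul_left_comm, ← Finset.prod_mul_distrib,
          MvPolynomial.algHom_C]
        congr 1
        refine Finset.prod_congr rfl fun i _ => ?_
        rw [map_pow, ← pow_mul, ← pow_add, mul_comm, Nat.div_add_mod]
      obtain ⟨g, hg⟩ : ι c ^ (q * (n * B)) * (algebraMap k T a * ∏ i, π (X i) ^ (u i % q)) ∈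
          ι.range := by
        have hsplit : ι c ^ (q * (n * B)) = ∏ _i : Fin n, (ι c ^ B) ^ q := by
          rw [Finset.prod_const, Finset.card_univ, Fintype.card_fin, ← pow_mul, ← pow_mul]
          congr 1
          ring
        rw [mul_left_comm, hsplit, ← Finset.prod_mul_distrib]
        refine mul_mem (Subalgebra.algebraMap_mem _ _) (prod_mem fun i _ => ?_)
        have hlt : u i % q < q := Nat.mod_lt _ (pow_pos (Fact.out : p.Prime).pos _)
        rw [← Nat.sub_add_cancel hlt.le, pow_add, mul_assoc, Nat.sub_add_cancel hlt.le, ← mul_pow]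
        exact mul_mem (pow_mem (pow_mem hcr _) _) (pow_mem (hB i) _)
      rw [hu]
      exact ⟨_, hsmul _ _ (ι (Φ g)) ⟨n * B, g, hg.symm, rfl⟩⟩
  choose φ hφ using htot
  let φ' : T →+ T := AddMonoidHom.mk' φ fun t t' =>
    hfun _ _ _ (hφ _) (hadd _ _ _ _ (hφ t) (hφ t'))
  have hφ' : IsCartierMap q φ' := fun a t => hfun _ _ _ (hφ _) (hsmul a t _ (hφ t))
  refine ⟨e, _, hφ'.comp_mulLeft (ι c ^ M₀), n * B, ?_⟩
  rw [AddMonoidHom.comp_apply, AddMonoidHom.coe_mulLeft, ← hd']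
  exact hfun _ _ _ (hφ _) ⟨0, d', by simp, by simp [hΦ1]⟩

end BirationalPolynomialRing

/-! ### The leading monomials of the four quadrics -/

namespace CommutatorT

open MvPolynomial

variable (k : Type*) [Field k]

/-- The weights of the 18 indeterminates.  They are chosen such that the terms of largest weight of
`f₁`, `f₂`, `f₃`, `f₄` and `denominator` are `-w₃₂z₂₃`, `w₂₁z₁₁`, `w₁₁z₁₂`, `w₁₃z₃₁` and
`z₂₁z₁₃w₂₃`, which involve 11 different indeterminates. -/
def wt : (Fin 3 × Fin 3) ⊕ (Fin 3 × Fin 3) → ℕ :=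
  Sum.elim (fun ij => !![7, 0, 3; 2, 0, 3; 2, 4, 0] ij.1 ij.2)
    (fun ij => !![7, 2, 4; 0, 0, 2; 5, 1, 0] ij.1 ij.2)

/-- A monomial order that compares weights first; the rule for breaking ties is immaterial. -/
noncomputable def order : MonomialOrder.{0, 0} ((Fin 3 × Fin 3) ⊕ (Fin 3 × Fin 3)) :=
  MonomialOrder.weighted wt (Classical.choice (MonomialOrder.nonempty_of_finite _))

/-- The polynomial `z₂₁(z₁₃w₂₃ - z₂₃w₁₃)`.  Where it is invertible, `f₁ = f₂ = f₃ = f₄ = 0` can be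
solved for `w₁₁`, `w₁₂`, `w₃₂`, `z₃₂`. -/
noncomputable def denominator : Poly k :=
  Z k 1 0 * (Z k 0 2 * W k 1 2 - Z k 1 2 * W k 0 2)

/-- The four generators as a family. -/
noncomputable def gens : Fin 4 → Poly k := ![f₁ k, f₂ k, f₃ k, f₄ k]

theorem span_range_gens : Ideal.span (Set.range (gens k)) = relations k := by
  simp only [relations, gens, Matrix.range_cons, Matrix.range_empty, Set.union_empty,
    Set.singleton_union]

variable {k}

theorem X_mul_X_mem {a b : (Fin 3 × Fin 3) ⊕ (Fin 3 × Fin 3)} {n : ℕ} (h : wt a + wt b < n) :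
    (X a * X b : Poly k) ∈ restrictSupport k {d | Finsupp.weight wt d < n} := by
  rw [X, X, monomial_mul]
  refine (monomial_mem_restrictSupport k).2 (Or.inl ?_)
  simpa [Finsupp.weight_single] using h

theorem degree_order {a b : (Fin 3 × Fin 3) ⊕ (Fin 3 × Fin 3)} {u : k} (hu : u ≠ 0)
    {f g : Poly k} (hf : f = C u * (X a * X b) + g)
    (hg : g ∈ restrictSupport k {d | Finsupp.weight wt d < wt a + wt b}) :
    order.degree f = Finsupp.single a 1 + Finsupp.single b 1 := by
  rw [hf, X, X, monomial_mul, C_mul_monomial, one_mul, mul_one]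
  refine MonomialOrder.degree_weighted_monomial_add hu ?_
  simpa [Finsupp.weight_single] using hg

theorem degree_f₁ : order.degree (f₁ k) =
    Finsupp.single (Sum.inl (2, 1)) 1 + Finsupp.single (Sum.inr (1, 2)) 1 :=
  degree_order (neg_ne_zero.2 one_ne_zero)
    (g := W k 1 0 * Z k 0 1 - W k 0 1 * Z k 1 0 + W k 1 2 * Z k 2 1)
    (by simp only [f₁, W, Z, Matrix.of_apply, map_neg, map_one]; ring)
    (add_mem (sub_mem (X_mul_X_mem (by decide)) (X_mul_X_mem (by decide)))
      (X_mul_X_mem (by decide)))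

theorem degree_f₂ : order.degree (f₂ k) =
    Finsupp.single (Sum.inl (1, 0)) 1 + Finsupp.single (Sum.inr (0, 0)) 1 :=
  degree_order one_ne_zero
    (g := W k 1 1 * Z k 1 0 - W k 1 0 * Z k 1 1 + W k 1 2 * Z k 2 0 - W k 2 0 * Z k 1 2
      - W k 0 0 * Z k 1 0)
    (by simp only [f₂, W, Z, Matrix.of_apply, map_one]; ring)
    (sub_mem (sub_mem (add_mem (sub_mem (X_mul_X_mem (by decide)) (X_mul_X_mem (by decide)))
      (X_mul_X_mem (by decide))) (X_mul_X_mem (by decide))) (X_mul_X_mem (by decide)))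

theorem degree_f₃ : order.degree (f₃ k) =
    Finsupp.single (Sum.inl (0, 0)) 1 + Finsupp.single (Sum.inr (0, 1)) 1 :=
  degree_order one_ne_zero
    (g := W k 0 2 * Z k 2 1 - W k 2 1 * Z k 0 2 - W k 1 1 * Z k 0 1 + W k 0 1 * Z k 1 1
      - W k 0 1 * Z k 0 0)
    (by simp only [f₃, W, Z, Matrix.of_apply, map_one]; ring)
    (sub_mem (add_mem (sub_mem (sub_mem (X_mul_X_mem (by decide)) (X_mul_X_mem (by decide)))
      (X_mul_X_mem (by decide))) (X_mul_X_mem (by decide))) (X_mul_X_mem (by decide)))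

theorem degree_f₄ : order.degree (f₄ k) =
    Finsupp.single (Sum.inl (0, 2)) 1 + Finsupp.single (Sum.inr (2, 0)) 1 :=
  degree_order one_ne_zero
    (g := W k 0 1 * Z k 1 0 - W k 1 0 * Z k 0 1 - W k 2 0 * Z k 0 2)
    (by simp only [f₄, W, Z, Matrix.of_apply, map_one]; ring)
    (sub_mem (sub_mem (X_mul_X_mem (by decide)) (X_mul_X_mem (by decide)))
      (X_mul_X_mem (by decide)))

theorem degree_minor : order.degree (Z k 0 2 * W k 1 2 - Z k 1 2 * W k 0 2) =
    Finsupp.single (Sum.inr (0, 2)) 1 + Finsupp.single (Sum.inl (1, 2)) 1 :=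
  degree_order one_ne_zero (g := - (Z k 1 2 * W k 0 2))
    (by simp only [W, Z, Matrix.of_apply, map_one]; ring)
    (neg_mem (X_mul_X_mem (by decide)))

theorem ne_zero_of_degree_eq {f : Poly k} {a b : (Fin 3 × Fin 3) ⊕ (Fin 3 × Fin 3)}
    (h : order.degree f = Finsupp.single a 1 + Finsupp.single b 1) : f ≠ 0 := by
  rintro rfl
  have := DFunLike.congr_fun h a
  simp only [MonomialOrder.degree_zero, Finsupp.coe_zero, Pi.zero_apply, Finsupp.add_apply,
    Finsupp.single_eq_same] at this
  omega

theorem minor_ne_zero : Z k 0 2 * W k 1 2 - Z k 1 2 * W k 0 2 ≠ 0 :=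
  ne_zero_of_degree_eq degree_minor

theorem Z_ne_zero (i j : Fin 3) : Z k i j ≠ 0 := X_ne_zero _

theorem denominator_ne_zero : denominator k ≠ 0 := mul_ne_zero (Z_ne_zero _ _) minor_ne_zero

theorem degree_denominator : order.degree (denominator k) = Finsupp.single (Sum.inr (1, 0)) 1 +
    (Finsupp.single (Sum.inr (0, 2)) 1 + Finsupp.single (Sum.inl (1, 2)) 1) := by
  rw [denominator, MonomialOrder.degree_mul (Z_ne_zero _ _) minor_ne_zero, degree_minor]
  congr 1
  exact MonomialOrder.degree_X

theorem gens_ne_zero (i : Fin 4) : gens k i ≠ 0 := by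
  fin_cases i
  exacts [ne_zero_of_degree_eq degree_f₁, ne_zero_of_degree_eq degree_f₂,
    ne_zero_of_degree_eq degree_f₃, ne_zero_of_degree_eq degree_f₄]

/-- The product of the four leading monomials and that of `denominator` is squarefree. -/
theorem sum_degree_gens_le (x : (Fin 3 × Fin 3) ⊕ (Fin 3 × Fin 3)) :
    ∑ i, order.degree (gens k i) x + order.degree (denominator k) x ≤ 1 := by
  simp only [Fin.sum_univ_four, gens, Matrix.cons_val, degree_f₁, degree_f₂, degree_f₃, degree_f₄,
    degree_denominator, Finsupp.add_apply, Finsupp.single_apply]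
  revert x
  decide

theorem disjoint_degree_denominator (i : Fin 4) :
    Disjoint (order.degree (gens k i)) (order.degree (denominator k)) := by
  rw [disjoint_iff]
  ext x
  have h1 := sum_degree_gens_le (k := k) x
  have h2 := Finset.single_le_sum (f := fun i => order.degree (gens k i) x)
    (fun _ _ => Nat.zero_le _) (Finset.mem_univ i)
  simp only [Finsupp.inf_apply, bot_eq_zero, Finsupp.coe_zero, Pi.zero_apply] at h2 ⊢
  omega

theorem pairwise_disjoint_degree_gens :
    Pairwise fun i j => Disjoint (order.degree (gens k i)) (order.degree (gens k j)) :=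
  pairwise_disjoint_degree fun x => (Nat.le_add_right _ _).trans (sum_degree_gens_le x)

theorem mk_denominator_mem_nonZeroDivisors :
    Ideal.Quotient.mk (relations k) (denominator k) ∈ nonZeroDivisors (T k) := by
  rw [mem_nonZeroDivisors_iff_right]
  intro t ht
  obtain ⟨h, rfl⟩ := Ideal.Quotient.mk_surjective t
  rw [← map_mul, Ideal.Quotient.eq_zero_iff_mem, ← span_range_gens, ← Set.image_univ,
    ← Finset.coe_univ] at ht
  rw [Ideal.Quotient.eq_zero_iff_mem, ← span_range_gens, ← Set.image_univ, ← Finset.coe_univ]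
  exact MonomialOrder.mem_span_of_mul_mem_span gens_ne_zero _
    (pairwise_disjoint_degree_gens.set_pairwise _) denominator_ne_zero
    (fun i _ => disjoint_degree_denominator i) ht

/-! ### Solving the equations -/

/-- The indeterminates other than `w₁₁`, `w₁₂`, `w₃₂`, `z₃₂`. -/
abbrev FreeIndex : Type :=
  {v : (Fin 3 × Fin 3) ⊕ (Fin 3 × Fin 3) //
    v ∉ ({Sum.inl (0, 0), Sum.inl (0, 1), Sum.inl (2, 1), Sum.inr (2, 1)} : Finset _)}

variable (k) in
/-- The inclusion of the polynomial ring in the free indeterminates into `T`. -/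
noncomputable def freeMap : MvPolynomial FreeIndex k →ₐ[k] T k :=
  (Ideal.Quotient.mkₐ k (relations k)).comp (rename Subtype.val)

variable (k) in
/-- The polynomial `denominator k`, in the free indeterminates. -/
noncomputable def freeDenominator : MvPolynomial FreeIndex k :=
  X ⟨Sum.inr (1, 0), by decide⟩ * (X ⟨Sum.inr (0, 2), by decide⟩ * X ⟨Sum.inl (1, 2), by decide⟩ -
    X ⟨Sum.inr (1, 2), by decide⟩ * X ⟨Sum.inl (0, 2), by decide⟩)

theorem freeMap_freeDenominator :
    freeMap k (freeDenominator k) = Ideal.Quotient.mk (relations k) (denominator k) := by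
  simp [freeMap, freeDenominator, denominator, W, Z]

/-- The values of the 18 indeterminates that are obtained by giving the free indeterminates the
values prescribed by `x` and solving `f₁ = f₂ = f₃ = f₄ = 0` for `w₁₁`, `w₁₂`, `w₃₂`, `z₃₂`. -/
def solution {K : Type*} [Field K] (x : (Fin 3 × Fin 3) ⊕ (Fin 3 × Fin 3) → K) :
    (Fin 3 × Fin 3) ⊕ (Fin 3 × Fin 3) → K :=
  let w i j := x (Sum.inl (i, j))
  let z i j := x (Sum.inr (i, j))
  let b := z 0 0 - z 1 1
  let A := w 2 0 * z 0 2 - w 0 2 * z 2 0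
  let B := (A * b - (w 1 2 * z 2 0 - w 2 0 * z 1 2) * z 0 1) / z 1 0
  let D := z 0 2 * w 1 2 - z 1 2 * w 0 2
  fun v =>
    if v = Sum.inl (0, 0) then
      w 1 1 + (w 1 0 * b + w 1 2 * z 2 0 - w 2 0 * z 1 2) / z 1 0
    else if v = Sum.inl (0, 1) then (w 1 0 * z 0 1 + A) / z 1 0
    else if v = Sum.inl (2, 1) then (w 0 2 * A - w 1 2 * B) / D
    else if v = Sum.inr (2, 1) then (z 0 2 * A - z 1 2 * B) / D
    else x v

/-- `solution x` is a common zero of `f₁`, `f₂`, `f₃`, `f₄`. -/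
theorem relations_le_ker_solution {K : Type*} [Field K] [Algebra k K]
    {x : (Fin 3 × Fin 3) ⊕ (Fin 3 × Fin 3) → K} (hz : x (Sum.inr (1, 0)) ≠ 0)
    (hD : x (Sum.inr (0, 2)) * x (Sum.inl (1, 2)) - x (Sum.inr (1, 2)) * x (Sum.inl (0, 2)) ≠ 0) :
    relations k ≤ RingHom.ker (aeval (R := k) (solution x)) := by
  refine Ideal.span_le.2 ?_
  -- naming `D` keeps `field_simp` from rewriting it into a form in which `hD` is not recognized
  rintro f (rfl | rfl | rfl | rfl) <;>
    simp only [SetLike.mem_coe, RingHom.mem_ker, f₁, f₂, f₃, f₄, W, Z, Matrix.of_apply, map_add,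
      map_sub, map_mul, aeval_X, solution, Sum.inl.injEq, Sum.inr.injEq, Prod.mk.injEq,
      reduceCtorEq, Fin.reduceEq, if_true, if_false, and_true, and_false]
  · generalize hDe : x (Sum.inr (0, 2)) * x (Sum.inl (1, 2)) -
      x (Sum.inr (1, 2)) * x (Sum.inl (0, 2)) = D at hD ⊢
    field_simp
    rw [← hDe]
    ring
  · field_simp
    ring
  · generalize hDe : x (Sum.inr (0, 2)) * x (Sum.inl (1, 2)) -
      x (Sum.inr (1, 2)) * x (Sum.inl (0, 2)) = D at hD ⊢
    field_simp
    rw [← hDe]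
    ring
  · field_simp
    ring

/-- The free indeterminates are algebraically independent in `T`, since `solution` extends each
assignment of values to them at which `denominator` does not vanish. -/
theorem freeMap_injective : Function.Injective (freeMap k) := by
  let x v := algebraMap (Poly k) (FractionRing (Poly k)) (X v)
  have hz : x (Sum.inr (1, 0)) ≠ 0 :=
    (map_ne_zero_iff _ (IsFractionRing.injective _ _)).2 (Z_ne_zero _ _)
  have hD : x (Sum.inr (0, 2)) * x (Sum.inl (1, 2)) - x (Sum.inr (1, 2)) * x (Sum.inl (0, 2))
      ≠ 0 := by
    simp only [x, ← map_mul, ← map_sub]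
    exact (map_ne_zero_iff _ (IsFractionRing.injective _ _)).2 minor_ne_zero
  rw [injective_iff_map_eq_zero]
  intro g hg
  have h1 : rename Subtype.val g ∈ relations k := Ideal.Quotient.eq_zero_iff_mem.1 hg
  have h2 : aeval (R := k) (solution x) (rename Subtype.val g) = 0 :=
    relations_le_ker_solution hz hD h1
  have h3 : (aeval (R := k) (solution x)).comp (rename (Subtype.val : FreeIndex → _)) =
      (IsScalarTower.toAlgHom k (Poly k) (FractionRing (Poly k))).comp
        (rename (Subtype.val : FreeIndex → _)) := by
    ext ⟨v, hv⟩
    simp only [Finset.mem_insert, Finset.mem_singleton, not_or] at hv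
    simp [solution, hv, x]
  have h4 := (DFunLike.congr_fun h3 g).symm.trans h2
  exact rename_injective _ Subtype.val_injective
    (IsFractionRing.injective (Poly k) (FractionRing (Poly k))
      (h4.trans (by simp)))

/-- After inverting `denominator`, the free indeterminates generate `T`. -/
theorem exists_pow_mul_mem_range_freeMap (t : T k) :
    ∃ M, freeMap k (freeDenominator k) ^ M * t ∈ (freeMap k).range := by
  obtain ⟨t, rfl⟩ := Ideal.Quotient.mk_surjective t
  have hc : freeMap k (freeDenominator k) ∈ (freeMap k).range := ⟨_, rfl⟩
  induction t using MvPolynomial.induction_on with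
  | C a => exact ⟨0, by rw [pow_zero, one_mul]; exact (freeMap k).range.algebraMap_mem a⟩
  | add s t hs ht =>
    obtain ⟨M, hM⟩ := hs
    obtain ⟨N, hN⟩ := ht
    refine ⟨M + N, ?_⟩
    rw [map_add, mul_add, pow_add]
    refine add_mem ?_ ?_
    · rw [mul_right_comm, mul_comm]
      exact mul_mem (pow_mem hc _) hM
    · rw [mul_assoc]
      exact mul_mem (pow_mem hc _) hN
  | mul_X t v ht =>
    obtain ⟨M, hM⟩ := ht
    suffices h : freeMap k (freeDenominator k) * Ideal.Quotient.mk _ (X v) ∈ (freeMap k).range by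
      refine ⟨M + 1, ?_⟩
      rw [map_mul, pow_succ, mul_mul_mul_comm]
      exact mul_mem hM h
    have hfree : ∀ v : FreeIndex, Ideal.Quotient.mk (relations k) (X v.1) ∈ (freeMap k).range :=
      fun v => ⟨X v, by simp [freeMap]⟩
    by_cases hv : v ∈ ({Sum.inl (0, 0), Sum.inl (0, 1), Sum.inl (2, 1), Sum.inr (2, 1)} : Finset _)
    swap
    · exact mul_mem hc (hfree ⟨v, hv⟩)
    have e₁ : Ideal.Quotient.mk (relations k) (f₁ k) = 0 :=
      Ideal.Quotient.eq_zero_iff_mem.2 (Ideal.subset_span (by simp))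
    have e₂ : Ideal.Quotient.mk (relations k) (f₂ k) = 0 :=
      Ideal.Quotient.eq_zero_iff_mem.2 (Ideal.subset_span (by simp))
    have e₃ : Ideal.Quotient.mk (relations k) (f₃ k) = 0 :=
      Ideal.Quotient.eq_zero_iff_mem.2 (Ideal.subset_span (by simp))
    have e₄ : Ideal.Quotient.mk (relations k) (f₄ k) = 0 :=
      Ideal.Quotient.eq_zero_iff_mem.2 (Ideal.subset_span (by simp))
    rw [freeMap_freeDenominator]
    simp only [f₁, f₂, f₃, f₄, denominator, W, Z, Matrix.of_apply, map_add, map_sub, map_mul]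
      at e₁ e₂ e₃ e₄ ⊢
    have hw₂₁ := hfree ⟨Sum.inl (1, 0), by decide⟩
    have hw₂₂ := hfree ⟨Sum.inl (1, 1), by decide⟩
    have hw₁₃ := hfree ⟨Sum.inl (0, 2), by decide⟩
    have hw₂₃ := hfree ⟨Sum.inl (1, 2), by decide⟩
    have hw₃₁ := hfree ⟨Sum.inl (2, 0), by decide⟩
    have hz₁₁ := hfree ⟨Sum.inr (0, 0), by decide⟩
    have hz₂₂ := hfree ⟨Sum.inr (1, 1), by decide⟩
    have hz₁₂ := hfree ⟨Sum.inr (0, 1), by decide⟩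
    have hz₂₁ := hfree ⟨Sum.inr (1, 0), by decide⟩
    have hz₁₃ := hfree ⟨Sum.inr (0, 2), by decide⟩
    have hz₂₃ := hfree ⟨Sum.inr (1, 2), by decide⟩
    have hz₃₁ := hfree ⟨Sum.inr (2, 0), by decide⟩
    simp only at hw₂₁ hw₂₂ hw₁₃ hw₂₃ hw₃₁ hz₁₁ hz₂₂ hz₁₂ hz₂₁ hz₁₃ hz₂₃ hz₃₁
    generalize Ideal.Quotient.mk (relations k) (X (Sum.inl (1, 0))) = w₂₁ at *
    generalize Ideal.Quotient.mk (relations k) (X (Sum.inl (1, 1))) = w₂₂ at *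
    generalize Ideal.Quotient.mk (relations k) (X (Sum.inl (0, 2))) = w₁₃ at *
    generalize Ideal.Quotient.mk (relations k) (X (Sum.inl (1, 2))) = w₂₃ at *
    generalize Ideal.Quotient.mk (relations k) (X (Sum.inl (2, 0))) = w₃₁ at *
    generalize Ideal.Quotient.mk (relations k) (X (Sum.inr (0, 0))) = z₁₁ at *
    generalize Ideal.Quotient.mk (relations k) (X (Sum.inr (1, 1))) = z₂₂ at *
    generalize Ideal.Quotient.mk (relations k) (X (Sum.inr (0, 1))) = z₁₂ at *
    generalize Ideal.Quotient.mk (relations k) (X (Sum.inr (1, 0))) = z₂₁ at *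
    generalize Ideal.Quotient.mk (relations k) (X (Sum.inr (0, 2))) = z₁₃ at *
    generalize Ideal.Quotient.mk (relations k) (X (Sum.inr (1, 2))) = z₂₃ at *
    generalize Ideal.Quotient.mk (relations k) (X (Sum.inr (2, 0))) = z₃₁ at *
    -- `w₁₁` and `w₁₂` come from `f₂` and `f₄`; after that, `f₁ + f₄` and `f₃` are two linear equations
    -- for `w₃₂` and `z₃₂`, of determinant `± D`, which Cramer's rule solves
    set D := z₁₃ * w₂₃ - z₂₃ * w₁₃ with hD
    have hDm : D ∈ (freeMap k).range := sub_mem (mul_mem hz₁₃ hw₂₃) (mul_mem hz₂₃ hw₁₃)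
    have hAm : w₃₁ * z₁₃ - w₁₃ * z₃₁ ∈ (freeMap k).range :=
      sub_mem (mul_mem hw₃₁ hz₁₃) (mul_mem hw₁₃ hz₃₁)
    have hbm : z₁₁ - z₂₂ ∈ (freeMap k).range := sub_mem hz₁₁ hz₂₂
    have hEm : w₂₃ * z₃₁ - w₃₁ * z₂₃ ∈ (freeMap k).range :=
      sub_mem (mul_mem hw₂₃ hz₃₁) (mul_mem hw₃₁ hz₂₃)
    have hBm := sub_mem (mul_mem hAm hbm) (mul_mem hEm hz₁₂)
    simp only [Finset.mem_insert, Finset.mem_singleton] at hv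
    rcases hv with rfl | rfl | rfl | rfl
    · convert mul_mem hDm (add_mem (add_mem (mul_mem hz₂₁ hw₂₂) (mul_mem hw₂₁ hbm)) hEm) using 1
      linear_combination (-D) * e₂
    · convert mul_mem hDm (add_mem (mul_mem hw₂₁ hz₁₂) hAm) using 1
      linear_combination D * e₄
    · convert sub_mem (mul_mem (mul_mem hw₁₃ hz₂₁) hAm) (mul_mem hw₂₃ hBm) using 1
      rw [hD]
      linear_combination w₁₃ * z₂₁ * (e₁ + e₄) -
        w₂₃ * (z₂₁ * e₃ + z₁₂ * e₂ + (z₁₁ - z₂₂) * e₄)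
    · convert sub_mem (mul_mem (mul_mem hz₁₃ hz₂₁) hAm) (mul_mem hz₂₃ hBm) using 1
      rw [hD]
      linear_combination z₁₃ * z₂₁ * (e₁ + e₄) -
        z₂₃ * (z₂₁ * e₃ + z₁₂ * e₂ + (z₁₁ - z₂₂) * e₄)

theorem freeMap_freeDenominator_mem_nonZeroDivisors :
    freeMap k (freeDenominator k) ∈ nonZeroDivisors (T k) :=
  freeMap_freeDenominator (k := k) ▸ mk_denominator_mem_nonZeroDivisors

instance : IsDomain (T k) :=
  isDomain_of_generically_polynomial freeMap_injective freeMap_freeDenominator_mem_nonZeroDivisors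
    exists_pow_mul_mem_range_freeMap

/-! ### Regularity of the sequence and strong `F`-regularity of the quotient -/

theorem exists_isCartierMap_denominator (p : ℕ) [Fact p.Prime] [CharP k p] (N : ℕ) :
    ∃ e, ∃ φ : T k →+ T k, IsCartierMap (p ^ e) φ ∧
      φ (Ideal.Quotient.mk _ (denominator k) ^ N) = 1 := by
  have h := exists_isCartierMap_quotient (m := order) p (gens_ne_zero (k := k))
    (fun x => (Nat.le_add_right _ _).trans (sum_degree_gens_le x)) denominator_ne_zero
    disjoint_degree_denominator N
  rw [span_range_gens] at h
  exact h

theorem isRegular_gens :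
    RingTheory.Sequence.IsRegular (Poly k) [f₁ k, f₂ k, f₃ k, f₄ k] where
  toIsWeaklyRegular := by
    have h := MonomialOrder.isWeaklyRegular_ofFn (gens_ne_zero (k := k))
      pairwise_disjoint_degree_gens
    simpa [gens, List.ofFn_succ] using h
  top_ne_smul := by
    have h : Ideal.ofList [f₁ k, f₂ k, f₃ k, f₄ k] = relations k := by
      rw [Ideal.ofList, relations]
      congr 1
      ext x
      simp
    rw [h, smul_eq_mul, Ideal.mul_top]
    exact (relations_ne_top k).symm

theorem isStronglyFRegular (p : ℕ) [Fact p.Prime] [CharP k p] : IsStronglyFRegular p (T k) where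
  isNoetherianRing := inferInstance
  isReduced := inferInstance
  exists_splitting d hd := by
    have hd0 : d ≠ 0 := by
      rintro rfl
      exact hd ⊥ (by rw [IsDomain.minimalPrimes_eq_singleton_bot]; rfl) (zero_mem _)
    have : Algebra.FiniteType k (T k) := inferInstance
    obtain ⟨e, φ, hφ, N, hN⟩ := exists_isCartierMap_eq_pow p freeMap_injective
      freeMap_freeDenominator_mem_nonZeroDivisors exists_pow_mul_mem_range_freeMap hd0
    obtain ⟨e', ψ, hψ, hψ1⟩ := exists_isCartierMap_denominator (k := k) p N
    have hcomp := hψ.comp hφ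
    rw [← pow_add] at hcomp
    exact ⟨e' + e, hcomp.exists_splitting (by
      rw [AddMonoidHom.comp_apply, hN, freeMap_freeDenominator, hψ1])⟩

end CommutatorT

theorem proposition3p1 {k : Type*} [Field k] (p : ℕ) [Fact p.Prime] [CharP k p] :
    RingTheory.Sequence.IsRegular (CommutatorT.Poly k)
        [CommutatorT.f₁ k, CommutatorT.f₂ k, CommutatorT.f₃ k, CommutatorT.f₄ k] ∧
      IsStronglyFRegular p (CommutatorT.T k) :=
  ⟨CommutatorT.isRegular_gens, CommutatorT.isStronglyFRegular p⟩
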